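/- Let $F$ be a group, and let $1\to A_i\to G_i\xrightarrow{\pi_i} F\to 1$ ($i=1,2$) be two central extensions of $F$ by abelian groups $A_1,A_2$, with $G_1$ and $G_2$ finite (central: the image of $A_i$ lies in the center $Z(G_i)$). Suppose that they are isoclinic as central extensions of $F$: there are isomorphisms $\eta:G_1/Z(G_1)\to G_2/Z(G_2)$ and $\nu:[G_1,G_1]\to[G_2,G_2]$ which commute with the commutator maps $G_i/Z(G_i)\times G_i/Z(G_i)\to[G_i,G_i]$, $(xZ(G_i),yZ(G_i))\mapsto xyx^{-1}y^{-1}$, and $\eta$ is compatible with the projections to $F$, that is, $\eta(g_1Z(G_1))=g_2Z(G_2)$ whenever $\pi_1(g_1)=\pi_2(g_2)$. Suppose moreover that $|G_1|=|G_2|$. Let $\mathcal R:F\to \mathrm{GL}(V)$ be a finite-dimensional complex linear representation, with lifts $\mathcal R_i=\mathcal R\circ\pi_i$. Then the McKay quivers $\mathcal Q(G_1,\mathcal R_1)$ and $\mathcal Q(G_2,\mathcal R_2)$ are isomorphic as quivers. Here, for a finite group $G$ and a finite-dimensional complex representation $\mathcal S$ of $G$, the McKay quiver $\mathcal Q(G,\mathcal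 S)$ has as vertices the equivalence classes of irreducible complex representations $\rho_1,\dots,\rho_n$ of $G$, and $a_{ij}$ arrows from $\rho_i$ to $\rho_j$, where $\mathcal S\otimes\rho_i\cong\bigoplus_{j=1}^n a_{ij}\,\rho_j$. -/

import Mathlib

noncomputable section

/-! ### Quivers up to isomorphism -/

/-- An isomorphism of quivers: a bijection on vertices together with, for all vertices `a`, `b`,
a bijection between the arrows `a ⟶ b` and the arrows between the corresponding vertices. -/
structure QuiverIso (Q₁ Q₂ : Type*) [Quiver Q₁] [Quiver Q₂] where
  vertexEquiv : Q₁ ≃ Q₂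
  arrowEquiv : ∀ a b : Q₁, (a ⟶ b) ≃ (vertexEquiv a ⟶ vertexEquiv b)

/-! ### Irreducible complex representations up to equivalence -/

/-- An irreducible finite-dimensional complex representation of `G`, on some `ℂⁿ`
(every finite-dimensional representation is equivalent to one on some `ℂⁿ`). -/
structure MatrixIrrep (G : Type*) [Group G] where
  dim : ℕ
  rep : Representation ℂ G (Fin dim → ℂ)
  irreducible : rep.IsIrreducible

/-- Equivalence of irreducible representations. -/
instance MatrixIrrep.setoid (G : Type*) [Group G] : Setoid (MatrixIrrep G) where
  r ρ σ := Nonempty (ρ.rep.Equiv σ.rep)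
  iseqv := ⟨fun ρ => ⟨Representation.Equiv.refl ρ.rep⟩, fun ⟨e⟩ => ⟨e.symm⟩,
    fun ⟨e⟩ ⟨f⟩ => ⟨e.trans f⟩⟩

/-- The set of equivalence classes of irreducible complex representations of `G`. -/
def IrrepClass (G : Type*) [Group G] : Type _ := Quotient (MatrixIrrep.setoid G)

/-- A representative of an equivalence class of irreducible representations. -/
def IrrepClass.out {G : Type*} [Group G] (j : IrrepClass G) : MatrixIrrep G := Quotient.out j

/-- The representation `⨁ⱼ m j • ρⱼ`, where `j` runs through the classes of irreducible
representations and `ρⱼ` is a representative of the class `j`. -/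
def isotypicSum {G : Type*} [Group G] (m : IrrepClass G → ℕ) :
    Representation ℂ G (DirectSum (Σ j : IrrepClass G, Fin (m j)) fun x => Fin x.1.out.dim → ℂ) :=
  Representation.directSum fun x => x.1.out.rep

/-- A simple submodule of the module of a representation is, as a representation, equivalent to
the representative of some class. -/
theorem exists_irrepClass_equiv {G V : Type*} [Group G] [AddCommGroup V] [Module ℂ V]
    [FiniteDimensional ℂ V] (ρ : Representation ℂ G V)
    (S : Submodule (MonoidAlgebra ℂ G) ρ.asModule) (hS : IsSimpleModule (MonoidAlgebra ℂ G) S) :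
    ∃ j : IrrepClass G, ∃ f : S ≃ₗ[ℂ] (Fin j.out.dim → ℂ),
      ∀ (g : G) (s : S), f (MonoidAlgebra.single g (1 : ℂ) • s) = j.out.rep g (f s) := by
  have hfin : FiniteDimensional ℂ S :=
    inferInstanceAs (FiniteDimensional ℂ (S.restrictScalars ℂ))
  let b : S ≃ₗ[ℂ] (Fin (Module.finrank ℂ S) → ℂ) := (Module.finBasis ℂ S).equivFun
  let τ : Representation ℂ G (Fin (Module.finrank ℂ S) → ℂ) :=
    { toFun := fun g => b.conj (Representation.ofModule' (k := ℂ) (G := G) S g)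
      map_one' := by ext; simp
      map_mul' := fun g h => by ext; simp }
  have hτ : ∀ (g : G) (s : S), b (MonoidAlgebra.single g (1 : ℂ) • s) = τ g (b s) := by
    intro g s
    simp [τ, Representation.ofModule', LinearEquiv.conj_apply_apply]
  let c : S ≃ₗ[MonoidAlgebra ℂ G] τ.asModule :=
    { toFun := fun s => τ.asModuleEquiv.symm (b s)
      invFun := fun v => b.symm (τ.asModuleEquiv v)
      left_inv := fun s => by simp
      right_inv := fun v => by simp
      map_add' := fun x y => by simp
      map_smul' := fun r s => by
        induction r using MonoidAlgebra.induction_linear with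
        | zero => simp
        | add x y hx hy => simp only [add_smul, map_add, RingHom.id_apply] at *; rw [hx, hy]
        | single g a =>
          have h : MonoidAlgebra.single g a = a • MonoidAlgebra.single g (1 : ℂ) := by simp
          rw [RingHom.id_apply, h, smul_assoc, smul_assoc, map_smul, map_smul, hτ]
          congr 1
          exact τ.asModuleEquiv_symm_map_rho g (b s) }
  have hirr : τ.IsIrreducible :=
    (Representation.irreducible_iff_isSimpleModule_asModule τ).2 (IsSimpleModule.congr c.symm)
  let M : MatrixIrrep G := ⟨_, τ, hirr⟩
  obtain ⟨φ⟩ : Nonempty (M.rep.Equiv (IrrepClass.out (Quotient.mk _ M)).rep) :=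
    Setoid.symm (Quotient.mk_out M)
  refine ⟨Quotient.mk _ M, b.trans φ.toLinearEquiv, fun g s => ?_⟩
  rw [LinearEquiv.trans_apply, hτ]
  exact φ.toIntertwiningMap.isIntertwining _ _ g (b s)

/-- Complete reducibility: every finite-dimensional complex representation of a finite group is
equivalent to a direct sum of irreducible representations. -/
theorem exists_equiv_isotypicSum {G V : Type*} [Group G] [Finite G] [AddCommGroup V] [Module ℂ V]
    [FiniteDimensional ℂ V] (ρ : Representation ℂ G V) :
    ∃ m : IrrepClass G → ℕ, Nonempty (ρ.Equiv (isotypicSum m)) := by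
  classical
  have hne : NeZero (Nat.card G : ℂ) := ⟨Nat.cast_ne_zero.2 Nat.card_pos.ne'⟩
  have hfd : FiniteDimensional ℂ ρ.asModule := inferInstanceAs (FiniteDimensional ℂ V)
  have hfin : Module.Finite (MonoidAlgebra ℂ G) ρ.asModule :=
    Module.Finite.of_restrictScalars_finite ℂ _ _
  obtain ⟨n, S, e, hS⟩ :=
    IsSemisimpleModule.exists_linearEquiv_fin_dfinsupp (MonoidAlgebra ℂ G) ρ.asModule
  choose c f hf using fun i => exists_irrepClass_equiv ρ (S i) (hS i)
  let h : (Σ j : IrrepClass G, Fin (Fintype.card {i // c i = j})) ≃ Fin n :=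
    (Equiv.sigmaCongrRight fun j => (Fintype.equivFin {i // c i = j}).symm).trans
      (Equiv.sigmaFiberEquiv c)
  have hc : ∀ x, c (h x) = x.1 := fun x => ((Fintype.equivFin {i // c i = x.1}).symm x.2).2
  have hf' : ∀ x, ∃ u : S (h x) ≃ₗ[ℂ] (Fin x.1.out.dim → ℂ), ∀ (g : G) (s : S (h x)),
      u (MonoidAlgebra.single g (1 : ℂ) • s) = x.1.out.rep g (u s) := by
    intro x
    rw [← hc x]
    exact ⟨f (h x), hf (h x)⟩
  choose u hu using hf'
  let L : V ≃ₗ[ℂ] DirectSum (Σ j : IrrepClass G, Fin (Fintype.card {i // c i = j}))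
      fun x => Fin x.1.out.dim → ℂ :=
    (ρ.asModuleEquiv.symm.trans (e.restrictScalars ℂ)).trans
      ((DirectSum.lequivCongrLeft ℂ h.symm).trans (DFinsupp.mapRange.linearEquiv u))
  have hL : ∀ v x, L v x = u x (e (ρ.asModuleEquiv.symm v) (h x)) := fun v x => rfl
  refine ⟨fun j => Fintype.card {i // c i = j}, ⟨Representation.Equiv.mk L fun g => ?_⟩⟩
  refine LinearMap.ext fun v => DFinsupp.ext fun x => ?_
  change L (ρ g v) x = x.1.out.rep g (L v x)
  rw [hL, hL, Representation.asModuleEquiv_symm_map_rho, map_smul, ← hu]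
  rfl

/-! ### McKay quivers -/

/-- The adjacency matrix of the McKay quiver of `G` relative to `R`: the entry `a i j` is the
multiplicity of `ρⱼ` in `R ⊗ ρᵢ`. -/
def mckayMatrix {G V : Type*} [Group G] [Finite G] [AddCommGroup V] [Module ℂ V]
    [FiniteDimensional ℂ V] (R : Representation ℂ G V) (i : IrrepClass G) : IrrepClass G → ℕ :=
  Classical.choose (exists_equiv_isotypicSum (R.tprod i.out.rep))

/-- The defining property of the adjacency matrix: `R ⊗ ρᵢ ≅ ⨁ⱼ a i j • ρⱼ`. -/
theorem mckayMatrix_spec {G V : Type*} [Group G] [Finite G] [AddCommGroup V] [Module ℂ V]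
    [FiniteDimensional ℂ V] (R : Representation ℂ G V) (i : IrrepClass G) :
    Nonempty ((R.tprod i.out.rep).Equiv (isotypicSum (mckayMatrix R i))) :=
  Classical.choose_spec (exists_equiv_isotypicSum (R.tprod i.out.rep))

/-- The vertex set of the McKay quiver of `G` relative to `R`: the classes of irreducible complex
representations of `G`. -/
@[nolint unusedArguments]
def McKayQuiver {G V : Type*} [Group G] [Finite G] [AddCommGroup V] [Module ℂ V]
    [FiniteDimensional ℂ V] (_R : Representation ℂ G V) : Type _ :=
  IrrepClass G

/-- The McKay quiver of `G` relative to `R` has `a i j` arrows from `i` to `j`. -/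
instance McKayQuiver.quiver {G V : Type*} [Group G] [Finite G] [AddCommGroup V] [Module ℂ V]
    [FiniteDimensional ℂ V] (R : Representation ℂ G V) : Quiver (McKayQuiver R) where
  Hom i j := Fin (mckayMatrix R i j)

/-! ### Isoclinism -/

open scoped commutatorElement

/-- The commutator map `G/Z(G) × G/Z(G) → [G, G]`, `(x Z(G), y Z(G)) ↦ [x, y]`. -/
def commutatorMap (G : Type*) [Group G] :
    G ⧸ Subgroup.center G → G ⧸ Subgroup.center G → commutator G :=
  Quotient.lift₂
    (fun x y => ⟨⁅x, y⁆, Subgroup.commutator_mem_commutator (Subgroup.mem_top x)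
      (Subgroup.mem_top y)⟩)
    (by
      intro a b a' b' ha hb
      apply Subtype.ext
      change ⁅a, b⁆ = ⁅a', b'⁆
      have ha' := QuotientGroup.leftRel_apply.1 ha
      have hb' := QuotientGroup.leftRel_apply.1 hb
      rw [Subgroup.mem_center_iff] at ha' hb'
      obtain ⟨z, hz, rfl⟩ : ∃ z, (∀ g : G, g * z = z * g) ∧ a' = a * z :=
        ⟨a⁻¹ * a', ha', by group⟩
      obtain ⟨w, hw, rfl⟩ : ∃ w, (∀ g : G, g * w = w * g) ∧ b' = b * w :=
        ⟨b⁻¹ * b', hb', by group⟩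
      have h1 : a * z * (b * w) = a * b * (z * w) := by
        rw [mul_assoc, ← mul_assoc z b w, ← hz b]; simp only [mul_assoc]
      have h2 : b * w * (a * z) = b * a * (z * w) := by
        rw [mul_assoc, ← mul_assoc w a z, ← hw a, hw z]; simp only [mul_assoc]
      have key : ⁅a * z, b * w⁆ = (a * z * (b * w)) * (b * w * (a * z))⁻¹ := by
        simp [commutatorElement_def, mul_assoc]
      rw [key, h1, h2]
      simp [commutatorElement_def, mul_assoc])

/-- An isoclinism between two groups: isomorphisms `η : G₁/Z(G₁) ≅ G₂/Z(G₂)` and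
`ν : [G₁, G₁] ≅ [G₂, G₂]` which commute with the commutator maps. -/
structure Isoclinism (G₁ G₂ : Type*) [Group G₁] [Group G₂] where
  η : G₁ ⧸ Subgroup.center G₁ ≃* G₂ ⧸ Subgroup.center G₂
  ν : commutator G₁ ≃* commutator G₂
  comm : ∀ x y, ν (commutatorMap G₁ x y) = commutatorMap G₂ (η x) (η y)

/-- A group extension is central if the image of its kernel is contained in the center. -/
def GroupExtension.IsCentral {A G F : Type*} [Group A] [Group G] [Group F]
    (S : GroupExtension A G F) : Prop :=
  S.inl.range ≤ Subgroup.center G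

/-- Two central extensions of the same group `F` are isoclinic if there is an isoclinism between
the groups whose component `η` is compatible with the projections to `F`: elements of `G₁` and `G₂`
over the same element of `F` have classes in `G₁/Z(G₁)` and `G₂/Z(G₂)` that correspond under `η`. -/
def GroupExtension.IsIsoclinic {A₁ A₂ G₁ G₂ F : Type*} [Group A₁] [Group A₂] [Group G₁] [Group G₂]
    [Group F] (S₁ : GroupExtension A₁ G₁ F) (S₂ : GroupExtension A₂ G₂ F) : Prop :=
  ∃ I : Isoclinism G₁ G₂, ∀ (g₁ : G₁) (g₂ : G₂), S₁.rightHom g₁ = S₂.rightHom g₂ →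
    I.η (QuotientGroup.mk g₁) = QuotientGroup.mk g₂

/-- The lift to `G` of a linear representation `R` of `F`, for an extension `G` of `F`. -/
def GroupExtension.liftRep {A G F V : Type*} [Group A] [Group G] [Group F] [AddCommGroup V]
    [Module ℂ V] (S : GroupExtension A G F) (R : Representation ℂ F V) : Representation ℂ G V :=
  R.comp S.rightHom

end

/-! Let `H` be the fiber product of `G₁` and `G₂` over `F`, with projections `p₁`, `p₂`. Both
kernels are central, and they have the same order because |G₁| = |G₂|. By the isoclinism every
element of [H, H] has the form (c, ν c), so [H, H] meets both kernels trivially, and linear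
characters of the kernels extend to `H`.

An irreducible representation ρ of `G₁`, pulled back to `H`, is scalar on `p₂.ker`, with some
character χ. Tensoring with a linear character λ of `H` that extends χ⁻¹ makes it trivial on
`p₂.ker`, hence a representation of `G₂`. If λ depends on χ alone, arrow multiplicities survive: the
pullback of R is trivial on the kernels, so arrows join only representations with the same χ, and
twisting both ends by the same λ preserves spaces of intertwining maps
(`nonempty_quiverIso_of_surjective`).

The new representation has character λ on `p₁.ker`, so the map on vertices is bijective once χ ↦ λ
restricted to `p₁.ker` is a bijection of dual groups. Equality of the kernel orders allows such a
choice of λ (`exists_equiv_characters`). -/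

/-! ### Matching linear characters of two subgroups -/

/-- If a group surjects onto two groups of the same finite order, then there is a bijection between
these two groups whose graph consists of images of elements of the group. -/
theorem exists_equiv_of_surjective_of_surjective {X A B : Type*} [CommGroup X] [CommGroup A]
    [CommGroup B] [Finite A] (r₁ : X →* A) (r₂ : X →* B)
    (h₁ : Function.Surjective r₁) (h₂ : Function.Surjective r₂) (hc : Nat.card A = Nat.card B) :
    ∃ φ : A ≃ B, ∀ a, ∃ x, r₁ x = a ∧ r₂ x = φ a := by
  have : Finite B := Nat.finite_of_card_ne_zero (hc ▸ Nat.card_pos.ne')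
  -- As in Goursat's lemma, a pair (a, b) comes from a single element of `X` exactly when a and b
  -- agree in the common quotient `X ⧸ K`. The fibers of `A` and `B` over it are equally large, so
  -- any fiberwise bijection will do.
  let K := r₁.ker ⊔ r₂.ker
  let q₁ : A →* X ⧸ K := r₁.liftOfSurjective h₁
    ⟨QuotientGroup.mk' K, by rw [QuotientGroup.ker_mk']; exact le_sup_left⟩
  let q₂ : B →* X ⧸ K := r₂.liftOfSurjective h₂
    ⟨QuotientGroup.mk' K, by rw [QuotientGroup.ker_mk']; exact le_sup_right⟩
  have e₁ : ∀ x, q₁ (r₁ x) = QuotientGroup.mk' K x := fun x =>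
    MonoidHom.liftOfRightInverse_comp_apply _ _ _ _ x
  have e₂ : ∀ x, q₂ (r₂ x) = QuotientGroup.mk' K x := fun x =>
    MonoidHom.liftOfRightInverse_comp_apply _ _ _ _ x
  have s₁ : Function.Surjective q₁ := fun c => by
    obtain ⟨x, rfl⟩ := QuotientGroup.mk'_surjective K c
    exact ⟨_, e₁ x⟩
  have s₂ : Function.Surjective q₂ := fun c => by
    obtain ⟨x, rfl⟩ := QuotientGroup.mk'_surjective K c
    exact ⟨_, e₂ x⟩
  have hk : Nat.card q₁.ker = Nat.card q₂.ker := by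
    have k₁ := q₁.ker.card_mul_index
    have k₂ := q₂.ker.card_mul_index
    rw [Subgroup.index_ker, MonoidHom.range_eq_top.2 s₁] at k₁
    rw [Subgroup.index_ker, MonoidHom.range_eq_top.2 s₂, ← hc, ← k₁] at k₂
    have : Finite (X ⧸ K) := Finite.of_surjective _ s₁
    exact (Nat.eq_of_mul_eq_mul_right Nat.card_pos k₂).symm
  let ek : q₁.ker ≃ q₂.ker := (Finite.card_eq.1 hk).some
  let φ : A ≃ B := Equiv.ofFiberEquiv (f := q₁) (g := q₂) fun c =>
    (MonoidHom.fiberEquivKerOfSurjective s₁ c).trans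
      (ek.trans (MonoidHom.fiberEquivKerOfSurjective s₂ c).symm)
  refine ⟨φ, fun a => ?_⟩
  have hφ : q₂ (φ a) = q₁ a := Equiv.ofFiberEquiv_map _ a
  obtain ⟨x, rfl⟩ := h₁ a
  obtain ⟨y, hy⟩ := h₂ (φ (r₁ x))
  rw [← hy, e₁, e₂] at hφ
  -- The factor in `r₁.ker` corrects `x` without moving its image in `A`; the factor in `r₂.ker` is
  -- invisible in `B`.
  have hxy : x⁻¹ * y ∈ K := QuotientGroup.eq.1 hφ.symm
  obtain ⟨k, hk, l, hl, hkl⟩ := Subgroup.mem_sup.1 hxy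
  rw [MonoidHom.mem_ker] at hk hl
  refine ⟨x * k, by rw [map_mul, hk, mul_one], ?_⟩
  rw [← hy, show y = x * k * l by rw [mul_assoc, hkl, mul_inv_cancel_left], map_mul r₂ (x * k), hl,
    mul_one]

section Characters

variable {H : Type*} [Group H] {N : Subgroup H}

/-- A subgroup that meets the commutator subgroup trivially embeds into the abelianization. -/
theorem abelianizationOf_comp_subtype_injective (hN : Disjoint N (commutator H)) :
    Function.Injective (Abelianization.of.comp N.subtype) := by
  rw [injective_iff_map_eq_one]
  intro n hn
  have : (n : H) ∈ commutator H := by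
    rw [← Abelianization.ker_of H]
    exact hn
  exact Subtype.ext (Subgroup.disjoint_def.1 hN n.2 this)

/-- Linear characters of a subgroup that meets the commutator subgroup trivially extend to the
whole group. -/
theorem domRestrictHom_surjective_of_disjoint [Finite H] (hN : Disjoint N (commutator H)) :
    Function.Surjective (MonoidHom.domRestrictHom N ℂˣ) := by
  intro χ
  -- Inside the finite abelianization, characters of subgroups extend because ℂ has enough roots of
  -- unity.
  let e := MonoidHom.ofInjective (abelianizationOf_comp_subtype_injective hN)
  obtain ⟨ψ, hψ⟩ := MonoidHom.domRestrict_surjective ℂ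
    (Abelianization.of.comp N.subtype).range (χ.comp e.symm.toMonoidHom)
  refine ⟨ψ.comp Abelianization.of, MonoidHom.ext fun n => ?_⟩
  have h : ψ (e n) = χ (e.symm (e n)) := DFunLike.congr_fun hψ (e n)
  rw [e.symm_apply_apply] at h
  exact h

/-- Being isomorphic to a subgroup of the abelianization, `N` is finite abelian, hence has as many
characters as elements. -/
theorem card_monoidHom_of_disjoint [Finite H] (hN : Disjoint N (commutator H)) :
    Nat.card (N →* ℂˣ) = Nat.card N := by
  let e := MonoidHom.ofInjective (abelianizationOf_comp_subtype_injective hN)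
  rw [Nat.card_congr e.toEquiv, 
    ← CommGroup.card_monoidHom_of_hasEnoughRootsOfUnity (Abelianization.of.comp N.subtype).range ℂ]
  exact Nat.card_congr e.monoidHomCongrLeftEquiv

end Characters

/-- For two subgroups of the same order that meet the commutator subgroup trivially, there is a
bijection between their linear characters such that, if `χ` and `ψ` correspond to each other,
then `χ⁻¹` and `ψ` have a common extension to the whole group. -/
theorem exists_equiv_characters {H : Type*} [Group H] [Finite H] {N₁ N₂ : Subgroup H}
    (h₁ : Disjoint N₁ (commutator H)) (h₂ : Disjoint N₂ (commutator H))
    (hc : Nat.card N₁ = Nat.card N₂) :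
    ∃ φ : (N₁ →* ℂˣ) ≃ (N₂ →* ℂˣ), ∀ χ, ∃ lam : H →* ℂˣ,
      (∀ n : N₁, lam n = (χ n)⁻¹) ∧ ∀ n : N₂, lam n = φ χ n := by
  have c₁ := card_monoidHom_of_disjoint h₁
  have c₂ := card_monoidHom_of_disjoint h₂
  have : Finite (N₁ →* ℂˣ) := Nat.finite_of_card_ne_zero (c₁ ▸ Nat.card_pos.ne')
  obtain ⟨φ, hφ⟩ := exists_equiv_of_surjective_of_surjective (MonoidHom.domRestrictHom N₁ ℂˣ)
    (MonoidHom.domRestrictHom N₂ ℂˣ) (domRestrictHom_surjective_of_disjoint h₁)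
    (domRestrictHom_surjective_of_disjoint h₂) (by rw [c₁, c₂, hc])
  refine ⟨(Equiv.inv _).trans φ, fun χ => ?_⟩
  obtain ⟨lam, hl₁, hl₂⟩ := hφ χ⁻¹
  exact ⟨lam, fun n => DFunLike.congr_fun hl₁ n, fun n => DFunLike.congr_fun hl₂ n⟩

/-! ### Arrow multiplicities as dimensions of spaces of intertwining maps -/

namespace Representation

/-- Intertwining maps from `ρ` to a direct sum correspond to families of intertwining maps from `ρ`
to those summands that are not known to be disjoint from `ρ`, if these are finite in number. -/
noncomputable def intertwiningMapDirectSumEquiv {k G W ι κ : Type*} {V : ι → Type*} [Field k] [Group G]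
    [AddCommGroup W] [Module k W] [∀ i, AddCommGroup (V i)] [∀ i, Module k (V i)]
    [Fintype κ] [DecidableEq ι]
    (ρ : Representation k G W) (σ : ∀ i, Representation k G (V i)) (c : κ ↪ ι)
    (hc : ∀ i, i ∉ Set.range c → Subsingleton (IntertwiningMap ρ (σ i))) :
    IntertwiningMap ρ (directSum σ) ≃ₗ[k] ∀ x, IntertwiningMap ρ (σ (c x)) where
  toFun f x := ⟨DirectSum.component k ι V (c x) ∘ₗ f.toLinearMap, fun g => by
    ext w
    exact congrArg (fun v => v (c x)) (f.isIntertwining _ _ g w)⟩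
  map_add' f g := rfl
  map_smul' a f := rfl
  invFun F := ∑ x, ⟨DirectSum.lof k ι V (c x) ∘ₗ (F x).toLinearMap, fun g => by
    ext w : 1
    change DirectSum.lof k ι V (c x) (F x (ρ g w)) =
      DirectSum.lmap (fun i => σ i g) (DirectSum.lof k ι V (c x) (F x w))
    rw [DirectSum.lmap_lof, (F x).isIntertwining]⟩
  left_inv f := by
    refine IntertwiningMap.ext (LinearMap.ext fun w => DFinsupp.ext fun i => ?_)
    rw [IntertwiningMap.toLinearMap_sum, LinearMap.sum_apply]
    change DirectSum.component k ι V i (∑ x, _) = _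
    rw [map_sum]
    change ∑ x, DirectSum.component k ι V i (DirectSum.lof k ι V (c x) (f w (c x))) = f w i
    by_cases hi : i ∈ Set.range c
    · obtain ⟨y, rfl⟩ := hi
      rw [Finset.sum_eq_single y]
      · rw [DirectSum.component.lof_self]
      · intro x _ hx
        rw [DirectSum.component.of, dif_neg (fun h => hx (c.injective h))]
      · simp
    · let fi : IntertwiningMap ρ (σ i) := ⟨DirectSum.component k ι V i ∘ₗ f.toLinearMap, fun g => by
        ext w
        exact congrArg (fun v => v i) (f.isIntertwining _ _ g w)⟩
      have h0 : fi = 0 := @Subsingleton.elim _ (hc i hi) _ _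
      rw [show f w i = fi w from rfl, h0]
      refine Finset.sum_eq_zero fun x _ => ?_
      rw [DirectSum.component.of, dif_neg (fun h => hi ⟨x, h⟩)]
  right_inv F := by
    funext y
    refine IntertwiningMap.ext (LinearMap.ext fun w => ?_)
    change DirectSum.component k ι V (c y)
      ((∑ x, _ : IntertwiningMap ρ (directSum σ)).toLinearMap w) = F y w
    rw [IntertwiningMap.toLinearMap_sum, LinearMap.sum_apply, map_sum]
    change ∑ x, DirectSum.component k ι V (c y) (DirectSum.lof k ι V (c x) (F x w)) = F y w
    rw [Finset.sum_eq_single y]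
    · rw [DirectSum.component.lof_self]
    · intro x _ hx
      rw [DirectSum.component.of, dif_neg (fun h => hx (c.injective h))]
    · simp

/-- Equivalent representations have the same space of intertwining maps into them. -/
noncomputable def Equiv.intertwiningMapCongrRight {k G W U U' : Type*} [Field k] [Group G]
    [AddCommGroup W] [Module k W] [AddCommGroup U] [Module k U] [AddCommGroup U'] [Module k U']
    (ρ : Representation k G W) {σ : Representation k G U} {σ' : Representation k G U'}
    (e : σ.Equiv σ') : IntertwiningMap ρ σ ≃ₗ[k] IntertwiningMap ρ σ' where
  toFun f := e.toIntertwiningMap.comp f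
  invFun f := e.symm.toIntertwiningMap.comp f
  map_add' f g := by ext; simp
  map_smul' a f := by ext; simp
  left_inv f := by ext; simp
  right_inv f := by ext; simp

end Representation

namespace IrrepClass

variable {G : Type*} [Group G]

instance (j : IrrepClass G) : j.out.rep.IsIrreducible := j.out.irreducible

theorem eq_of_equiv_out {i j : IrrepClass G} (e : i.out.rep.Equiv j.out.rep) : i = j := by
  rw [← Quotient.out_eq i, ← Quotient.out_eq j]
  exact Quotient.sound ⟨e⟩

theorem exists_out_equiv (M : MatrixIrrep G) :
    ∃ j : IrrepClass G, Nonempty (M.rep.Equiv j.out.rep) :=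
  ⟨Quotient.mk _ M, Setoid.symm (Quotient.mk_out M)⟩

/-- The multiplicity of an irreducible representation in a direct sum of irreducible
representations is the dimension of a space of intertwining maps. -/
theorem finrank_intertwiningMap_isotypicSum (m : IrrepClass G → ℕ) (j : IrrepClass G) :
    Module.finrank ℂ (Representation.IntertwiningMap j.out.rep (isotypicSum m)) = m j := by
  classical
  -- By Schur's lemma only the `m j` summands of class `j` receive nonzero maps, so the total number
  -- of classes need not be finite.
  let c : Fin (m j) ↪ Σ j : IrrepClass G, Fin (m j) := Function.Embedding.sigmaMk (β := fun j => Fin (m j)) j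
  have hc : ∀ x, x ∉ Set.range c →
      Subsingleton (Representation.IntertwiningMap j.out.rep x.1.out.rep) := by
    rintro ⟨i, x⟩ hx
    have : IsEmpty (j.out.rep.Equiv i.out.rep) := ⟨fun e => by
      obtain rfl := eq_of_equiv_out e
      exact hx ⟨x, rfl⟩⟩
    infer_instance
  have e := Representation.intertwiningMapDirectSumEquiv j.out.rep (fun x => x.1.out.rep) c hc
  have : Module.finrank ℂ (∀ x, Representation.IntertwiningMap j.out.rep (c x).1.out.rep) = m j := by
    rw [Module.finrank_pi_fintype]
    have h : ∀ x, Module.finrank ℂ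
        (Representation.IntertwiningMap j.out.rep (c x).1.out.rep) = 1 := fun x =>
      Representation.IsIrreducible.finrank_intertwiningMap_self j.out.rep
    simp [h]
  rw [← this]
  exact e.finrank_eq

end IrrepClass

/-- This replaces the multiplicities of a chosen decomposition by an invariant that can be compared
across groups. -/
theorem mckayMatrix_eq_finrank {G V : Type*} [Group G] [Finite G] [AddCommGroup V] [Module ℂ V]
    [FiniteDimensional ℂ V] (R : Representation ℂ G V) (i j : IrrepClass G) :
    mckayMatrix R i j =
      Module.finrank ℂ (Representation.IntertwiningMap j.out.rep (R.tprod i.out.rep)) := by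
  obtain ⟨e⟩ := mckayMatrix_spec R i
  rw [← IrrepClass.finrank_intertwiningMap_isotypicSum (mckayMatrix R i) j]
  exact (e.intertwiningMapCongrRight j.out.rep).finrank_eq.symm

/-! ### Twisting by linear characters -/

namespace Representation

section Twist

variable {H G₁ G₂ U W U' W' V : Type*} [Group H] [Group G₁] [Group G₂]
  [AddCommGroup U] [Module ℂ U] [AddCommGroup W] [Module ℂ W]
  [AddCommGroup U'] [Module ℂ U'] [AddCommGroup W'] [Module ℂ W'] [AddCommGroup V] [Module ℂ V]
  {p₁ : H →* G₁} {p₂ : H →* G₂} {lam : H →* ℂˣ}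
  {ρ : Representation ℂ G₁ U} {σ : Representation ℂ G₂ W}
  {ρ' : Representation ℂ G₁ U'} {σ' : Representation ℂ G₂ W'}

/-- Representations `ρ` of `G₁` and `σ` of `G₂` are twists of each other, with respect to
homomorphisms from `H` to both groups and a linear character `lam` of `H`, if the pullback of `σ`
to `H` is equivalent to the tensor product of `lam` with the pullback of `ρ`. -/
def IsTwist (p₁ : H →* G₁) (p₂ : H →* G₂) (lam : H →* ℂˣ)
    (ρ : Representation ℂ G₁ U) (σ : Representation ℂ G₂ W) : Prop :=
  ∃ e : U ≃ₗ[ℂ] W, ∀ h u, σ (p₂ h) (e u) = lam h • e (ρ (p₁ h) u)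

theorem IsTwist.symm (t : IsTwist p₁ p₂ lam ρ σ) : IsTwist p₂ p₁ lam⁻¹ σ ρ := by
  obtain ⟨e, he⟩ := t
  refine ⟨e.symm, fun h w => ?_⟩
  have := he h (e.symm w)
  rw [e.apply_symm_apply] at this
  rw [this, MonoidHom.inv_apply, Units.smul_def, Units.smul_def, map_smul, e.symm_apply_apply,
    smul_smul, Units.inv_mul, one_smul]

theorem IsTwist.trans_equiv (t : IsTwist p₁ p₂ lam ρ σ) {σ' : Representation ℂ G₂ W'}
    (f : σ.Equiv σ') : IsTwist p₁ p₂ lam ρ σ' := by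
  obtain ⟨e, he⟩ := t
  refine ⟨e.trans f.toLinearEquiv, fun h u => ?_⟩
  have h₁ : f (σ (p₂ h) (e u)) = σ' (p₂ h) (f (e u)) :=
    f.toIntertwiningMap.isIntertwining _ _ _ _
  change σ' (p₂ h) (f (e u)) = lam h • f (e (ρ (p₁ h) u))
  rw [← h₁, he, Units.smul_def, Units.smul_def, map_smul]

/-- Twists of a representation by the same character are equivalent. -/
theorem IsTwist.equiv_right (hp₂ : Function.Surjective p₂) {σ' : Representation ℂ G₂ W'}
    (t : IsTwist p₁ p₂ lam ρ σ) (t' : IsTwist p₁ p₂ lam ρ σ') : Nonempty (σ.Equiv σ') := by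
  obtain ⟨e, he⟩ := t
  obtain ⟨e', he'⟩ := t'
  refine ⟨Equiv.mk (e.symm.trans e') fun g => ?_⟩
  obtain ⟨h, rfl⟩ := hp₂ g
  refine LinearMap.ext fun w => ?_
  obtain ⟨u, rfl⟩ := e.surjective w
  simp [he, he', Units.smul_def]

theorem IsTwist.equiv_left (hp₁ : Function.Surjective p₁) {ρ' : Representation ℂ G₁ U'}
    (t : IsTwist p₁ p₂ lam ρ σ) (t' : IsTwist p₁ p₂ lam ρ' σ) : Nonempty (ρ.Equiv ρ') :=
  t.symm.equiv_right hp₁ t'.symm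

/-- Scalar factors do not affect which subspaces are invariant, so `e` matches the
subrepresentations of both sides. -/
theorem IsTwist.isIrreducible (hp₁ : Function.Surjective p₁) (hp₂ : Function.Surjective p₂)
    (t : IsTwist p₁ p₂ lam ρ σ) (hρ : ρ.IsIrreducible) : σ.IsIrreducible := by
  obtain ⟨e, he⟩ := t
  let f : Subrepresentation σ ≃o Subrepresentation ρ :=
    { toFun := fun S => ⟨S.toSubmodule.comap e.toLinearMap, fun g u hu => by
        obtain ⟨h, rfl⟩ := hp₁ g
        have := S.apply_mem_toSubmodule (p₂ h) hu
        change σ (p₂ h) (e u) ∈ _ at this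
        rw [he] at this
        exact (Submodule.smul_mem_iff' S.toSubmodule (lam h)).1 this⟩
      invFun := fun S => ⟨S.toSubmodule.map e.toLinearMap, fun g w hw => by
        obtain ⟨h, rfl⟩ := hp₂ g
        obtain ⟨u, hu, rfl⟩ := hw
        change σ (p₂ h) (e u) ∈ _
        rw [he]
        exact (Submodule.smul_mem_iff' _ (lam h)).2
          (Submodule.mem_map_of_mem (S.apply_mem_toSubmodule (p₁ h) hu))⟩
      left_inv := fun S => Subrepresentation.ext
        (Submodule.map_comap_eq_of_surjective e.surjective _)
      right_inv := fun S => Subrepresentation.ext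
        (Submodule.comap_map_eq_of_injective e.injective _)
      map_rel_iff' := fun {S T} =>
        Submodule.comap_le_comap_iff_of_surjective (f := e.toLinearMap) e.surjective }
  exact f.isSimpleOrder_iff.2 hρ

theorem IsTwist.tprod {R₁ : Representation ℂ G₁ V} {R₂ : Representation ℂ G₂ V}
    (hR : ∀ h, R₁ (p₁ h) = R₂ (p₂ h)) (t : IsTwist p₁ p₂ lam ρ σ) :
    IsTwist p₁ p₂ lam (R₁.tprod ρ) (R₂.tprod σ) := by
  obtain ⟨e, he⟩ := t
  refine ⟨LinearEquiv.lTensor V e, fun h x => ?_⟩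
  induction x with
  | zero => simp
  | add x y hx hy => simp only [map_add, smul_add, hx, hy]
  | tmul v u => simp [hR, he, Units.smul_def]

/-- Twisting by a linear character preserves the dimension of spaces of intertwining maps. -/
theorem IsTwist.finrank_intertwiningMap (hp₁ : Function.Surjective p₁)
    (hp₂ : Function.Surjective p₂) (t : IsTwist p₁ p₂ lam ρ σ) (t' : IsTwist p₁ p₂ lam ρ' σ') :
    Module.finrank ℂ (IntertwiningMap ρ ρ') = Module.finrank ℂ (IntertwiningMap σ σ') := by
  obtain ⟨e, he⟩ := t
  obtain ⟨e', he'⟩ := t'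
  -- Conjugation by `e` and `e'` respects the actions because both twists use the same `lam`, whose
  -- values cancel.
  let c : (U →ₗ[ℂ] U') ≃ₗ[ℂ] (W →ₗ[ℂ] W') := LinearEquiv.arrowCongr e e'
  let L : IntertwiningMap ρ ρ' ≃ₗ[ℂ] IntertwiningMap σ σ' :=
    { toFun := fun f => ⟨c f.toLinearMap, fun g => by
        obtain ⟨h, rfl⟩ := hp₂ g
        refine LinearMap.ext fun w => ?_
        obtain ⟨u, rfl⟩ := e.surjective w
        have := f.isIntertwining _ _ (p₁ h) u
        simp [c, he, he', Units.smul_def, this]⟩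
      invFun := fun f => ⟨c.symm f.toLinearMap, fun g => by
        obtain ⟨h, rfl⟩ := hp₁ g
        refine LinearMap.ext fun u => e'.injective ?_
        have := f.isIntertwining _ _ (p₂ h) (e u)
        have h' := he' h (e'.symm (f (e u)))
        rw [he, Units.smul_def, map_smul] at this
        rw [e'.apply_symm_apply, ← this, ← Units.smul_def] at h'
        simpa [c] using smul_left_cancel _ h'⟩
      map_add' := fun f g => IntertwiningMap.ext (map_add c _ _)
      map_smul' := fun a f => IntertwiningMap.ext (map_smul c _ _)
      left_inv := fun f => IntertwiningMap.ext (c.symm_apply_apply _)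
      right_inv := fun f => IntertwiningMap.ext (c.apply_symm_apply _) }
  exact L.finrank_eq

/-- The twist of a representation of `G₁` by a linear character exists as a representation of
`G₂` on the same space, if the twisted pullback is trivial on the kernel. -/
theorem exists_isTwist (hp₂ : Function.Surjective p₂) (ρ : Representation ℂ G₁ U)
    (hk : ∀ h ∈ p₂.ker, ∀ u, lam h • ρ (p₁ h) u = u) :
    ∃ σ : Representation ℂ G₂ U, IsTwist p₁ p₂ lam ρ σ := by
  let τ : Representation ℂ H U :=
    { toFun := fun h => (lam h : ℂ) • ρ (p₁ h)
      map_one' := by simp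
      map_mul' := fun h h' => by
        ext u
        simp [smul_smul, mul_comm] }
  -- The twisted pullback `τ` is constant on the fibers of `p₂`, so it descends to `G₂` through any
  -- choice of preimages.
  have hτ : ∀ h h', p₂ h = p₂ h' → τ h = τ h' := by
    intro h h' hh
    have hm : h⁻¹ * h' ∈ p₂.ker := by simp [MonoidHom.mem_ker, hh]
    have h1 : τ (h⁻¹ * h') = 1 := LinearMap.ext fun u => hk _ hm u
    rw [show h' = h * (h⁻¹ * h') by group, map_mul, h1, mul_one]
  refine ⟨{ toFun := fun g => τ (Function.surjInv hp₂ g), map_one' := ?_, map_mul' := ?_ },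
    LinearEquiv.refl _ _, fun h u => ?_⟩
  · rw [← map_one τ]
    exact hτ _ _ (by rw [Function.surjInv_eq hp₂, map_one])
  · intro g g'
    rw [← map_mul τ]
    exact hτ _ _ (by simp only [Function.surjInv_eq hp₂, map_mul])
  · exact DFunLike.congr_fun (hτ _ h (Function.surjInv_eq hp₂ _)) u

end Twist

/-! ### Central characters -/

section CentralCharacter

variable {G U : Type*} [Group G] [AddCommGroup U] [Module ℂ U]

/-- Elements of the center act by scalars in an irreducible representation. -/
theorem exists_smul_of_mem_center [FiniteDimensional ℂ U] (ρ : Representation ℂ G U) [ρ.IsIrreducible] {z : G}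
    (hz : z ∈ Subgroup.center G) : ∃ a : ℂ, ∀ u, ρ z u = a • u := by
  obtain ⟨a, ha⟩ := (IsIrreducible.algebraMap_intertwiningMap_bijective_of_isAlgClosed
    (ρ := ρ)).2 (IntertwiningMap.centralMul ρ z hz)
  exact ⟨a, fun u => (DFunLike.congr_fun ha u).symm⟩

theorem IsIrreducible.nontrivial_space (ρ : Representation ℂ G U) [hρ : ρ.IsIrreducible] :
    Nontrivial U := by
  by_contra h
  rw [not_nontrivial_iff_subsingleton] at h
  obtain ⟨S, T, hST⟩ := hρ.exists_pair_ne
  exact hST (Subrepresentation.ext (Subsingleton.elim _ _))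

/-- A group that maps to the center acts in an irreducible representation by a linear character. -/
theorem exists_centralCharacter [FiniteDimensional ℂ U] {N : Type*} [Group N] (ρ : Representation ℂ G U)
    [ρ.IsIrreducible] (f : N →* G) (hf : ∀ n, f n ∈ Subgroup.center G) :
    ∃ χ : N →* ℂˣ, ∀ n u, ρ (f n) u = χ n • u := by
  choose a ha using fun n => exists_smul_of_mem_center ρ (hf n)
  have := IsIrreducible.nontrivial_space ρ
  obtain ⟨u, hu⟩ := exists_ne (0 : U)
  -- A scalar is determined by its effect on the nonzero vector `u`, which gives multiplicativity;
  -- the values are units because `N` is a group.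
  let b : N →* ℂ :=
    { toFun := a
      map_one' := smul_left_injective ℂ hu (by simp [← ha])
      map_mul' := fun m n => smul_left_injective ℂ hu (by
        simp only [← ha, mul_smul, map_mul, Module.End.mul_apply]) }
  exact ⟨b.toHomUnits, fun n u => ha n u⟩

/-- There are no nonzero intertwining maps between representations with different central
characters, also after tensoring with a representation with trivial central character. -/
theorem finrank_intertwiningMap_tprod_eq_zero {N V W : Type*} [Group N]
    [AddCommGroup V] [Module ℂ V] [AddCommGroup W] [Module ℂ W] (f : N →* G)
    (R : Representation ℂ G V) {ρ : Representation ℂ G U} {σ : Representation ℂ G W}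
    {χ ψ : N →* ℂˣ} (hR : ∀ n, R (f n) = 1) (hρ : ∀ n u, ρ (f n) u = χ n • u)
    (hσ : ∀ n w, σ (f n) w = ψ n • w) (hne : χ ≠ ψ) :
    Module.finrank ℂ (IntertwiningMap ρ (R.tprod σ)) = 0 := by
  have h0 : ∀ F : IntertwiningMap ρ (R.tprod σ), F = 0 := fun F => by
    by_contra hF
    obtain ⟨u, hu⟩ : ∃ u, F u ≠ 0 := by
      by_contra! h
      exact hF (IntertwiningMap.ext (LinearMap.ext h))
    have hRσ : ∀ n x, R.tprod σ (f n) x = ψ n • x := fun n x => by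
      induction x with
      | zero => simp
      | add x y hx hy => rw [map_add, smul_add, hx, hy]
      | tmul v w => simp [hR, hσ, Units.smul_def]
    refine hne (MonoidHom.ext fun n => Units.ext (smul_left_injective ℂ hu ?_))
    have := F.isIntertwining _ _ (f n) u
    rw [hρ, hRσ, Units.smul_def, map_smul] at this
    exact this
  have : Subsingleton (IntertwiningMap ρ (R.tprod σ)) := ⟨fun F F' => by rw [h0 F, h0 F']⟩
  exact Module.finrank_zero_of_subsingleton

end CentralCharacter

end Representation

/-! ### Comparison of the McKay quivers through a common cover -/

open Representation in
/-- Let a finite group `H` map onto `G₁` and `G₂` with central kernels of the same order that meet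
the commutator subgroup of `H` trivially. Then the McKay quivers of `G₁` and `G₂` relative to
representations with the same pullback to `H` are isomorphic. -/
theorem nonempty_quiverIso_of_surjective {H G₁ G₂ V : Type*} [Group H] [Finite H] [Group G₁]
    [Finite G₁] [Group G₂] [Finite G₂] [AddCommGroup V] [Module ℂ V] [FiniteDimensional ℂ V]
    {p₁ : H →* G₁} {p₂ : H →* G₂} (hp₁ : Function.Surjective p₁) (hp₂ : Function.Surjective p₂)
    (hz₁ : p₁.ker ≤ Subgroup.center H) (hz₂ : p₂.ker ≤ Subgroup.center H)
    (hd₁ : Disjoint p₁.ker (commutator H)) (hd₂ : Disjoint p₂.ker (commutator H))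
    (hc : Nat.card p₁.ker = Nat.card p₂.ker)
    (R₁ : Representation ℂ G₁ V) (R₂ : Representation ℂ G₂ V) (hR : ∀ h, R₁ (p₁ h) = R₂ (p₂ h)) :
    Nonempty (QuiverIso (McKayQuiver R₁) (McKayQuiver R₂)) := by
  -- The order is swapped because representations of `G₁` are trivial on `p₁.ker` and have their
  -- central character on `p₂.ker`. The twist `Λ χ` depends on `χ` alone.
  obtain ⟨φ, hφ⟩ := exists_equiv_characters hd₂ hd₁ hc.symm
  choose Λ hΛ₂ hΛ₁ using hφ
  have hm₁ : ∀ n : p₂.ker, (p₁.comp p₂.ker.subtype) n ∈ Subgroup.center G₁ := fun n => by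
    rw [Subgroup.mem_center_iff]
    intro g
    obtain ⟨h, rfl⟩ := hp₁ g
    simpa using congrArg p₁ (Subgroup.mem_center_iff.1 (hz₂ n.2) h)
  have hm₂ : ∀ n : p₁.ker, (p₂.comp p₁.ker.subtype) n ∈ Subgroup.center G₂ := fun n => by
    rw [Subgroup.mem_center_iff]
    intro g
    obtain ⟨h, rfl⟩ := hp₂ g
    simpa using congrArg p₂ (Subgroup.mem_center_iff.1 (hz₁ n.2) h)
  choose χ₁ hχ₁ using fun i : IrrepClass G₁ => exists_centralCharacter i.out.rep _ hm₁
  choose χ₂ hχ₂ using fun j : IrrepClass G₂ => exists_centralCharacter j.out.rep _ hm₂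
  -- the central characters of a representation and of its twist determine the twisting character
  have htw₂ : ∀ {lam i j}, IsTwist p₁ p₂ lam (IrrepClass.out i).rep (IrrepClass.out j).rep →
      ∀ n : p₁.ker, χ₂ j n = lam n := by
    rintro lam i j ⟨e, he⟩ n
    have := IsIrreducible.nontrivial_space i.out.rep
    obtain ⟨u, hu⟩ := exists_ne (0 : Fin i.out.dim → ℂ)
    have h := he n u
    rw [show p₁ n = 1 from n.2, map_one, Module.End.one_apply] at h
    have h' := (hχ₂ j n (e u)).symm.trans h
    exact Units.ext (smul_left_injective ℂ (e.map_ne_zero_iff.2 hu) h')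
  have htw₁ : ∀ {lam i j}, IsTwist p₁ p₂ lam (IrrepClass.out i).rep (IrrepClass.out j).rep →
      ∀ n : p₂.ker, χ₁ i n = (lam n)⁻¹ := by
    rintro lam i j t n
    obtain ⟨e, he⟩ := t.symm
    have := IsIrreducible.nontrivial_space j.out.rep
    obtain ⟨u, hu⟩ := exists_ne (0 : Fin j.out.dim → ℂ)
    have h := he n u
    rw [show p₂ n = 1 from n.2, map_one, Module.End.one_apply] at h
    have h' := (hχ₁ i n (e u)).symm.trans h
    exact Units.ext (smul_left_injective ℂ (e.map_ne_zero_iff.2 hu) h')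
  have hF : ∀ i, ∃ j : IrrepClass G₂, IsTwist p₁ p₂ (Λ (χ₁ i)) i.out.rep j.out.rep := fun i => by
    obtain ⟨σ, hσ⟩ := exists_isTwist (lam := Λ (χ₁ i)) hp₂ i.out.rep fun h hh u => by
      rw [show i.out.rep (p₁ h) u = _ from hχ₁ i ⟨h, hh⟩ u, smul_smul,
        show Λ (χ₁ i) h = _ from hΛ₂ (χ₁ i) ⟨h, hh⟩, inv_mul_cancel, one_smul]
    obtain ⟨j, ⟨f⟩⟩ := IrrepClass.exists_out_equiv
      ⟨_, σ, hσ.isIrreducible hp₁ hp₂ i.out.irreducible⟩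
    exact ⟨j, hσ.trans_equiv f⟩
  choose Φ hΦ using hF
  have hχΦ : ∀ i, χ₂ (Φ i) = φ (χ₁ i) := fun i => MonoidHom.ext fun n => by
    rw [htw₂ (hΦ i), hΛ₁]
  -- The central character of `Φ i` recovers that of `i` through `φ`, hence the twist used, which
  -- can then be undone.
  have hinj : Function.Injective Φ := fun i i' h => by
    have hχ : χ₁ i = χ₁ i' := φ.injective (by rw [← hχΦ, ← hχΦ, h])
    obtain ⟨f⟩ := (hΦ i).equiv_left hp₁ (by rw [hχ, h]; exact hΦ i')
    exact IrrepClass.eq_of_equiv_out f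
  have hsurj : Function.Surjective Φ := fun j => by
    obtain ⟨χ, hχ⟩ := φ.surjective (χ₂ j)
    obtain ⟨ρ, hρ⟩ := exists_isTwist (lam := (Λ χ)⁻¹) hp₁ j.out.rep fun h hh u => by
      rw [show j.out.rep (p₂ h) u = _ from hχ₂ j ⟨h, hh⟩ u, smul_smul, MonoidHom.inv_apply,
        show Λ χ h = _ from hΛ₁ χ ⟨h, hh⟩, hχ, inv_mul_cancel, one_smul]
    obtain ⟨i, ⟨f⟩⟩ := IrrepClass.exists_out_equiv
      ⟨_, ρ, hρ.isIrreducible hp₂ hp₁ j.out.irreducible⟩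
    have t : IsTwist p₁ p₂ (Λ χ) i.out.rep j.out.rep := by
      rw [← inv_inv (Λ χ)]
      exact (hρ.trans_equiv f).symm
    have hχi : χ₁ i = χ := MonoidHom.ext fun n => by rw [htw₁ t, hΛ₂, inv_inv]
    have t' := hΦ i
    rw [hχi] at t'
    obtain ⟨g⟩ := t'.equiv_right hp₂ t
    exact ⟨i, IrrepClass.eq_of_equiv_out g⟩
  -- On `p₂.ker` the pullback of `R₁` agrees with that of `R₂`, which is trivial there; so tensoring
  -- with `R₁` keeps the central character.
  have hzero₁ : ∀ i j, χ₁ i ≠ χ₁ j → mckayMatrix R₁ i j = 0 := fun i j hij => by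
    rw [mckayMatrix_eq_finrank]
    refine finrank_intertwiningMap_tprod_eq_zero (p₁.comp p₂.ker.subtype) R₁ (fun n => ?_)
      (hχ₁ j) (hχ₁ i) hij.symm
    rw [MonoidHom.comp_apply, hR, Subgroup.subtype_apply, show p₂ n = 1 from n.2, map_one]
  have hzero₂ : ∀ i j, χ₂ i ≠ χ₂ j → mckayMatrix R₂ i j = 0 := fun i j hij => by
    rw [mckayMatrix_eq_finrank]
    refine finrank_intertwiningMap_tprod_eq_zero (p₂.comp p₁.ker.subtype) R₂ (fun n => ?_)
      (hχ₂ j) (hχ₂ i) hij.symm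
    rw [MonoidHom.comp_apply, ← hR, Subgroup.subtype_apply, show p₁ n = 1 from n.2, map_one]
  have hmat : ∀ i j, mckayMatrix R₁ i j = mckayMatrix R₂ (Φ i) (Φ j) := fun i j => by
    by_cases hij : χ₁ i = χ₁ j
    · rw [mckayMatrix_eq_finrank, mckayMatrix_eq_finrank]
      have t := hΦ j
      rw [← hij] at t
      exact t.finrank_intertwiningMap hp₁ hp₂ ((hΦ i).tprod hR)
    · rw [hzero₁ i j hij, hzero₂]
      rw [hχΦ, hχΦ]
      exact fun h => hij (φ.injective h)
  exact ⟨⟨Equiv.ofBijective Φ ⟨hinj, hsurj⟩, fun i j => finCongr (hmat i j)⟩⟩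

/-! ### The fiber product of the two extensions -/

section FiberProduct

variable {F A₁ A₂ G₁ G₂ : Type*} [Group F] [Group A₁] [Group A₂] [Group G₁] [Group G₂]

/-- The fiber product of two group extensions of the same group. -/
def GroupExtension.fiberProduct (S₁ : GroupExtension A₁ G₁ F) (S₂ : GroupExtension A₂ G₂ F) :
    Subgroup (G₁ × G₂) :=
  (S₁.rightHom.comp (MonoidHom.fst G₁ G₂)).eqLocus (S₂.rightHom.comp (MonoidHom.snd G₁ G₂))

/-- An isoclinism of extensions identifies the commutator subgroup of the fiber product with the
graph of the isomorphism between the commutator subgroups. -/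
theorem GroupExtension.exists_eq_of_mem_commutator_fiberProduct {S₁ : GroupExtension A₁ G₁ F}
    {S₂ : GroupExtension A₂ G₂ F} (I : Isoclinism G₁ G₂)
    (hI : ∀ (g₁ : G₁) (g₂ : G₂), S₁.rightHom g₁ = S₂.rightHom g₂ →
      I.η (QuotientGroup.mk g₁) = QuotientGroup.mk g₂)
    {h : S₁.fiberProduct S₂} (hh : h ∈ commutator (S₁.fiberProduct S₂)) :
    ∃ c : commutator G₁, (h : G₁ × G₂) = ((c : G₁), (I.ν c : G₂)) := by
  let D : Subgroup (S₁.fiberProduct S₂) :=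
    ((commutator G₁).subtype.prod ((commutator G₂).subtype.comp I.ν.toMonoidHom)).range.comap
      (S₁.fiberProduct S₂).subtype
  -- It suffices to treat commutators. The two coordinates of an element lie over the same point of
  -- `F`, so `η` matches their classes, and `ν` takes the commutator of the first coordinates to
  -- that of the second ones.
  have hD : commutator (S₁.fiberProduct S₂) ≤ D := by
    rw [commutator_def, Subgroup.commutator_le]
    intro x _ y _
    refine ⟨commutatorMap G₁ (QuotientGroup.mk x.1.1) (QuotientGroup.mk y.1.1), ?_⟩
    refine Prod.ext rfl ?_
    change ((I.ν (commutatorMap G₁ _ _) : commutator G₂) : G₂) = _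
    rw [I.comm, hI x.1.1 x.1.2 x.2, hI y.1.1 y.1.2 y.2]
    rfl
  obtain ⟨c, hc⟩ := hD hh
  exact ⟨c, hc.symm⟩

end FiberProduct

theorem mainTheorem1 {F A₁ A₂ G₁ G₂ V : Type*} [Group F] [CommGroup A₁] [CommGroup A₂]
    [Group G₁] [Group G₂] [Finite G₁] [Finite G₂]
    [AddCommGroup V] [Module ℂ V] [FiniteDimensional ℂ V]
    (S₁ : GroupExtension A₁ G₁ F) (S₂ : GroupExtension A₂ G₂ F)
    (hS₁ : S₁.IsCentral) (hS₂ : S₂.IsCentral)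
    (hiso : S₁.IsIsoclinic S₂) (hcard : Nat.card G₁ = Nat.card G₂)
    (R : Representation ℂ F V) :
    Nonempty (QuiverIso (McKayQuiver (S₁.liftRep R)) (McKayQuiver (S₂.liftRep R))) := by
  obtain ⟨I, hI⟩ := hiso
  let H := S₁.fiberProduct S₂
  let p₁ : H →* G₁ := (MonoidHom.fst G₁ G₂).comp H.subtype
  let p₂ : H →* G₂ := (MonoidHom.snd G₁ G₂).comp H.subtype
  have hH : ∀ h : H, S₁.rightHom (p₁ h) = S₂.rightHom (p₂ h) := fun h => h.2
  have hp₁ : Function.Surjective p₁ := fun g => by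
    obtain ⟨g', hg'⟩ := S₂.rightHom_surjective (S₁.rightHom g)
    exact ⟨⟨(g, g'), hg'.symm⟩, rfl⟩
  have hp₂ : Function.Surjective p₂ := fun g => by
    obtain ⟨g', hg'⟩ := S₁.rightHom_surjective (S₂.rightHom g)
    exact ⟨⟨(g', g), hg'⟩, rfl⟩
  have hker₁ : S₁.rightHom.ker ≤ Subgroup.center G₁ := S₁.range_inl_eq_ker_rightHom ▸ hS₁
  have hker₂ : S₂.rightHom.ker ≤ Subgroup.center G₂ := S₂.range_inl_eq_ker_rightHom ▸ hS₂
  refine nonempty_quiverIso_of_surjective hp₁ hp₂ ?_ ?_ ?_ ?_ ?_ _ _ fun h => congrArg R (hH h)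
  -- The second coordinate of `h` lies over 1 in `F`, hence in the central kernel of `S₂`.
  · intro h (hh : p₁ h = 1)
    have hz : p₂ h ∈ Subgroup.center G₂ := hker₂ (by rw [MonoidHom.mem_ker, ← hH, hh, map_one])
    refine Subgroup.mem_center_iff.2 fun g => Subtype.ext (Prod.ext ?_ ?_)
    · change p₁ (g * h) = p₁ (h * g)
      rw [map_mul, map_mul, hh, mul_one, one_mul]
    · exact Subgroup.mem_center_iff.1 hz (p₂ g)
  · intro h (hh : p₂ h = 1)
    have hz : p₁ h ∈ Subgroup.center G₁ := hker₁ (by rw [MonoidHom.mem_ker, hH, hh, map_one])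
    refine Subgroup.mem_center_iff.2 fun g => Subtype.ext (Prod.ext ?_ ?_)
    · exact Subgroup.mem_center_iff.1 hz (p₁ g)
    · change p₂ (g * h) = p₂ (h * g)
      rw [map_mul, map_mul, hh, mul_one, one_mul]
  -- An element (c, ν c) is trivial as soon as one coordinate is; for the second coordinate this
  -- uses injectivity of `ν`.
  · refine Subgroup.disjoint_def.2 fun {h} (hh : p₁ h = 1) hc => ?_
    obtain ⟨c, hc⟩ := GroupExtension.exists_eq_of_mem_commutator_fiberProduct I hI hc
    have h1 : c = 1 := Subtype.ext ((congrArg Prod.fst hc).symm.trans hh)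
    exact Subtype.ext (by rw [hc, h1, map_one]; rfl)
  · refine Subgroup.disjoint_def.2 fun {h} (hh : p₂ h = 1) hc => ?_
    obtain ⟨c, hc⟩ := GroupExtension.exists_eq_of_mem_commutator_fiberProduct I hI hc
    have h1 : c = 1 := I.ν.injective
      (Subtype.ext ((congrArg Prod.snd hc).symm.trans (hh.trans (by rw [map_one]; rfl))))
    exact Subtype.ext (by rw [hc, h1, map_one]; rfl)
  -- Each kernel has order |H| / |Gᵢ|.
  · have k₁ := p₁.ker.card_mul_index
    have k₂ := p₂.ker.card_mul_index
    rw [Subgroup.index_ker, MonoidHom.range_eq_top.2 hp₁, Subgroup.card_top] at k₁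
    rw [Subgroup.index_ker, MonoidHom.range_eq_top.2 hp₂, Subgroup.card_top, ← hcard] at k₂
    exact Nat.eq_of_mul_eq_mul_right Nat.card_pos (k₁.trans k₂.symm)
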